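/- An (abstract) operator system is a triple $(V,\{C_n\}_{n},e)$ where $V$ is a complex vector space with a conjugate-linear involution $*$, each $C_n\subseteq M_n(V)$ is a convex cone of hermitian matrices, $\alpha^*C_n\alpha\subseteq C_m$ for all scalar matrices $\alpha\in M_{n,m}(\mathbb C)$, $C_n\cap(-C_n)=\{0\}$, and $e=e^*\in V$ is an Archimedean matrix order unit: writing $v_n=I_n\otimes v$, for every hermitian $x\in M_n(V)$ there is $r>0$ with $re_n-x\in C_n$, and $x\in C_n$ whenever $re_n+x\in C_n$ for all $r>0$. The space $M_2(V)$ is an operator system with unit $e_2$ and the cones of $M_n(M_2(V))\cong M_{2n}(V)$; $B(H)$ is an operator system with unit $I_H$ and the positive operators in $M_n(B(H))\cong B(H^n)$. A linear map $\varphi$ between spaces with such cones is a complete order embedding if it is injective and, for every $n$ and $x\in M_n(V)$, the matrix $x$ is positive if and only if $\varphi_n(x)$, obtained by applying $\varphi$ entrywise, is positive; that is, $\varphi$ is a complete order isomorphism onto its range. For an operator system $(W,\{D_n\},u)$ and $r\in W$ with $0\le r\le u$, let \[ C(r_n)=\{x\in M_n(W): x=x^*,\ \forall\varepsilon>0\ \exists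 t>0:\ x+\varepsilon r_n+t(u-r)_n\in D_n\},\qquad J_r=\operatorname{span}\bigl(C(r)\cap -C(r)\bigr), \] and equip $W/J_r$ with the cones $\{(x_{ij}+J_r)_{ij}: x\in C(r_n)\}$. An element $p\in V$ is an abstract projection if $0\le p\le e$, if $\sup\{|\varphi(p)|:\varphi \text{ a state of } V\}=1$ (a state being a positive linear functional with $\varphi(e)=1$), and if, with $q=e-p$, the map \[ \pi_p:V\to M_2(V)/J_{p\oplus q},\qquad x\mapsto\begin{pmatrix}x&x\\x&x\end{pmatrix}+J_{p\oplus q} \] is a complete order isomorphism onto its range. Theorem. Let $V$ be an operator system with unit $e$ and let $p\in V$ be an abstract projection. Then there exist a Hilbert space $H$ and a linear complete order embedding $\pi:V\to B(H)$ with $\pi(e)=I_H$ such that $\pi(p)$ is a projection, i.e. $\pi(p)=\pi(p)^2=\pi(p)^*$. -/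

import Mathlib

open scoped ComplexOrder

universe u

/-! ### Operator systems

A complex `*`-vector space is a type `V` with instances `[AddCommGroup V] [Module ℂ V]
[StarAddMonoid V] [StarModule ℂ V]`. -/

/-- A choice of a set `C n ⊆ M_n(V)` of positive elements for every `n`. -/
abbrev MatrixCones (V : Type*) : Type _ := ∀ n : ℕ, Set (Matrix (Fin n) (Fin n) V)

/-- The `m × m` matrix `α* x α` over `V`, for a scalar matrix `α ∈ M_{n,m}` and `x ∈ M_n(V)`. -/
def scalarConj {V : Type*} [AddCommGroup V] [Module ℂ V] {n m : ℕ}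
    (α : Matrix (Fin n) (Fin m) ℂ) (x : Matrix (Fin n) (Fin n) V) : Matrix (Fin m) (Fin m) V :=
  Matrix.of fun k l => ∑ i, ∑ j, (star (α i k) * α j l) • x i j

/-- The amplification `I_n ⊗ v ∈ M_n(V)` of `v ∈ V`. -/
def amp {V : Type*} [AddCommGroup V] (n : ℕ) (v : V) : Matrix (Fin n) (Fin n) V :=
  Matrix.diagonal fun _ => v

/-- `v ∈ V` is positive: as a `1 × 1` matrix it lies in the first cone. -/
def IsPos {V : Type*} (C : MatrixCones V) (v : V) : Prop :=
  (Matrix.of fun _ _ => v : Matrix (Fin 1) (Fin 1) V) ∈ C 1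

/-- A (not necessarily proper) matrix ordering: convex cones of hermitian matrices which are
compatible with conjugation by rectangular scalar matrices. -/
structure IsMatrixOrdering {V : Type*} [AddCommGroup V] [Module ℂ V] [StarAddMonoid V]
    [StarModule ℂ V] (C : MatrixCones V) : Prop where
  isHermitian : ∀ (n : ℕ), ∀ x ∈ C n, x.IsHermitian
  zero_mem : ∀ n : ℕ, (0 : Matrix (Fin n) (Fin n) V) ∈ C n
  add_mem : ∀ (n : ℕ), ∀ x ∈ C n, ∀ y ∈ C n, x + y ∈ C n
  smul_mem : ∀ (n : ℕ) (r : ℝ), 0 ≤ r → ∀ x ∈ C n, (r : ℂ) • x ∈ C n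
  scalarConj_mem : ∀ (n m : ℕ) (α : Matrix (Fin n) (Fin m) ℂ), ∀ x ∈ C n, scalarConj α x ∈ C m

/-- `(V, C, e)` is an abstract operator system: `C` is a proper matrix ordering on the
`*`-vector space `V` and `e` is an Archimedean matrix order unit. -/
structure IsOperatorSystem {V : Type*} [AddCommGroup V] [Module ℂ V] [StarAddMonoid V]
    [StarModule ℂ V] (C : MatrixCones V) (e : V) : Prop extends IsMatrixOrdering C where
  proper : ∀ (n : ℕ) (x : Matrix (Fin n) (Fin n) V), x ∈ C n → -x ∈ C n → x = 0
  unit_isSelfAdjoint : IsSelfAdjoint e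
  matrix_order_unit : ∀ (n : ℕ) (x : Matrix (Fin n) (Fin n) V), x.IsHermitian →
    ∃ r : ℝ, 0 < r ∧ (r : ℂ) • amp n e - x ∈ C n
  archimedean : ∀ (n : ℕ) (x : Matrix (Fin n) (Fin n) V), x.IsHermitian →
    (∀ r : ℝ, 0 < r → (r : ℂ) • amp n e + x ∈ C n) → x ∈ C n

/-- A complete order embedding: a completely positive injective linear map whose inverse is
completely positive on its range, the range carrying the cones of the codomain.
Here `x.map φ` is the amplification `φ_n` applied to `x ∈ M_n(V)`. -/
structure IsCompleteOrderEmbedding {V W : Type*} [AddCommGroup V] [Module ℂ V]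
    [AddCommGroup W] [Module ℂ W] (C : MatrixCones V) (D : MatrixCones W)
    (φ : V →ₗ[ℂ] W) : Prop where
  injective : Function.Injective φ
  map_mem : ∀ (n : ℕ) (x : Matrix (Fin n) (Fin n) V), x ∈ C n → x.map φ ∈ D n
  mem_of_map_mem : ∀ (n : ℕ) (x : Matrix (Fin n) (Fin n) V), x.map φ ∈ D n → x ∈ C n

/-! ### The operator system `B(H)` -/

/-- The operator on the Hilbert space `H^n` with operator matrix `x ∈ M_n(B(H))`. -/
noncomputable def blockOperator {H : Type*} [NormedAddCommGroup H] [InnerProductSpace ℂ H] {n : ℕ}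
    (x : Matrix (Fin n) (Fin n) (H →L[ℂ] H)) :
    PiLp 2 (fun _ : Fin n => H) →L[ℂ] PiLp 2 (fun _ : Fin n => H) :=
  ((PiLp.continuousLinearEquiv 2 ℂ (fun _ : Fin n => H)).symm :
      (Fin n → H) →L[ℂ] PiLp 2 (fun _ : Fin n => H)) ∘L
    (ContinuousLinearMap.pi fun i => ∑ j, x i j ∘L ContinuousLinearMap.proj j) ∘L
    (PiLp.continuousLinearEquiv 2 ℂ (fun _ : Fin n => H) :
      PiLp 2 (fun _ : Fin n => H) →L[ℂ] (Fin n → H))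

/-- The standard cones of `B(H)`: an element of `M_n(B(H))` is positive iff it is a positive
operator on `H^n`. -/
def operatorCones (H : Type*) [NormedAddCommGroup H] [InnerProductSpace ℂ H] :
    MatrixCones (H →L[ℂ] H) :=
  fun _ => {x | (blockOperator x).IsPositive}

/-! ### The minimal order norm -/

/-- A state: a unital positive linear functional. -/
structure IsState {V : Type*} [AddCommGroup V] [Module ℂ V] (C : MatrixCones V) (e : V)
    (φ : V →ₗ[ℂ] ℂ) : Prop where
  map_unit : φ e = 1
  map_nonneg : ∀ v : V, IsPos C v → 0 ≤ φ v

/-- The minimal order norm `α_m(v) = sup {|φ(v)| : φ a state}`. -/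
noncomputable def minOrderNorm {V : Type*} [AddCommGroup V] [Module ℂ V] (C : MatrixCones V)
    (e v : V) : ℝ :=
  sSup {r : ℝ | ∃ φ : V →ₗ[ℂ] ℂ, IsState C e φ ∧ r = ‖φ v‖}

/-! ### Matrices over an operator system, and abstract compressions -/

/-- The cones of `M_k(V)`: an element of `M_n(M_k(V))` is positive iff the corresponding
element of `M_{nk}(V)` is. -/
def matrixSystemCones {V : Type*} (C : MatrixCones V) (k : ℕ) :
    MatrixCones (Matrix (Fin k) (Fin k) V) :=
  fun n => {x | Matrix.reindex finProdFinEquiv finProdFinEquiv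
    (Matrix.comp (Fin n) (Fin n) (Fin k) (Fin k) V x) ∈ C (n * k)}

/-- The positive cones `C(p_n)` relative to `p`: the hermitian `x ∈ M_n(V)` such that for every
`ε > 0` there is `t > 0` with `x + ε p_n + t (e - p)_n ∈ C n`. -/
def relativeCones {V : Type*} [AddCommGroup V] [Module ℂ V] [StarAddMonoid V]
    (C : MatrixCones V) (e p : V) : MatrixCones V :=
  fun n => {x | x.IsHermitian ∧ ∀ ε : ℝ, 0 < ε → ∃ t : ℝ, 0 < t ∧
    x + (ε : ℂ) • amp n p + (t : ℂ) • amp n (e - p) ∈ C n}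

/-- The subspace `J_p = span (C(p) ∩ -C(p))`. -/
def compressionKernel {V : Type*} [AddCommGroup V] [Module ℂ V] [StarAddMonoid V]
    (C : MatrixCones V) (e p : V) : Submodule ℂ V :=
  Submodule.span ℂ {v | IsPos (relativeCones C e p) v ∧ IsPos (relativeCones C e p) (-v)}

/-- The cones of the abstract compression `V / J_p`: the images of the `C(p_n)`. -/
def compressionCones {V : Type*} [AddCommGroup V] [Module ℂ V] [StarAddMonoid V]
    (C : MatrixCones V) (e p : V) : MatrixCones (V ⧸ compressionKernel C e p) :=
  fun n => {y | ∃ x ∈ relativeCones C e p n, x.map (compressionKernel C e p).mkQ = y}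

/-! ### Abstract projections -/

/-- The element `p ⊕ q` of `M_2(V)`. -/
def diagPair {V : Type*} [AddCommGroup V] (p q : V) : Matrix (Fin 2) (Fin 2) V :=
  !![p, 0; 0, q]

/-- The linear map `V → M_2(V)` sending `x` to the matrix all of whose entries are `x`. -/
def constMatrix (V : Type*) [AddCommGroup V] [Module ℂ V] : V →ₗ[ℂ] Matrix (Fin 2) (Fin 2) V where
  toFun x := !![x, x; x, x]
  map_add' x y := by ext i j; fin_cases i <;> fin_cases j <;> rfl
  map_smul' c x := by ext i j; fin_cases i <;> fin_cases j <;> rfl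

/-- `p` is an abstract projection of `(V, C, e)`: `0 ≤ p ≤ e`, `α_m(p) = 1`, and, with
`q = e - p`, the map `π_p : V → M_2(V) / J_{p ⊕ q}`, `x ↦ [x x; x x] + J_{p ⊕ q}`, is a complete
order isomorphism onto its range. -/
structure IsAbstractProjection {V : Type*} [AddCommGroup V] [Module ℂ V] [StarAddMonoid V]
    (C : MatrixCones V) (e p : V) : Prop where
  pos : IsPos C p
  le_unit : IsPos C (e - p)
  minOrderNorm_eq_one : minOrderNorm C e p = 1
  isCompleteOrderEmbedding :
    IsCompleteOrderEmbedding C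
      (compressionCones (matrixSystemCones C 2) (amp 2 e) (diagPair p (e - p)))
      ((compressionKernel (matrixSystemCones C 2) (amp 2 e) (diagPair p (e - p))).mkQ ∘ₗ
        constMatrix V)

/-! Put `q = e - p`. The cone `C((p ⊕ q)_n)` contains `(q ⊕ p)_n` with both signs, so a functional
`s` on `M_n(M_2(V))` that is positive on this cone vanishes there. Each such `s` gives a completely
positive map from `V` to the sesquilinear forms on `ℂⁿ ⊗ ℂ²`, sending `x` to `(ξ, η) ↦ s (ξ* η ⊗
x)`. By Cauchy–Schwarz the vanishing makes the form of `q` zero on `ℂⁿ ⊗ e_0` and that of `p` zero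
on `ℂⁿ ⊗ e_1`. Hence the form of `p` is that of `e` composed with a coordinate projection
(`toForm_eq_firstComponent`).

The orthogonal direct sum over all `n` and `s` becomes, by a GNS construction, a unital map into
`B(H)` that sends `p` to a projection (`exists_embedding`). It detects positivity: at the vectors
`e_a ⊗ (1, 1)` the summand of `s` returns the value of `s` at the amplified matrix `[x x; x x]`. If
all these values are nonnegative, separation (`exists_positive_functional_of_notMem`) puts that
matrix in `C((p ⊕ q)_n)`, and the hypothesis on `π_p` then gives `x ∈ C n`. -/

/-! ### Separation from an Archimedean cone -/

theorem exists_positive_functional_of_notMem {M : Type*} [AddCommGroup M] [Module ℂ M]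
    [StarAddMonoid M] [StarModule ℂ M] (K : Set M) (w : M)
    (isSelfAdjoint : ∀ x ∈ K, IsSelfAdjoint x)
    (add_mem : ∀ x ∈ K, ∀ y ∈ K, x + y ∈ K)
    (smul_mem : ∀ r : ℝ, 0 ≤ r → ∀ x ∈ K, (r : ℂ) • x ∈ K)
    (hw : IsSelfAdjoint w)
    (order_unit : ∀ x, IsSelfAdjoint x → ∃ r : ℝ, 0 < r ∧ (r : ℂ) • w - x ∈ K)
    (archimedean : ∀ x, IsSelfAdjoint x → (∀ r : ℝ, 0 < r → (r : ℂ) • w + x ∈ K) → x ∈ K)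
    {h : M} (hh : IsSelfAdjoint h) (hK : h ∉ K) :
    ∃ s : M →ₗ[ℂ] ℂ, (∀ x, s (star x) = star (s x)) ∧ (∀ x ∈ K, 0 ≤ s x) ∧ ¬ 0 ≤ s h := by
  have smul_mem' : ∀ r : ℝ, 0 ≤ r → ∀ x ∈ K, r • x ∈ K := fun r hr x hx => by
    simpa using smul_mem r hr x hx
  have order_unit' : ∀ x, IsSelfAdjoint x → ∃ r : ℝ, 0 < r ∧ r • w - x ∈ K := fun x hx => by
    simpa using order_unit x hx
  have zero_mem : (0 : M) ∈ K := by
    obtain ⟨r, -, hr⟩ := order_unit' 0 (.zero _)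
    simpa using smul_mem' 0 le_rfl _ hr
  have w_mem : w ∈ K := by
    obtain ⟨r, hr, h⟩ := order_unit' 0 (.zero _)
    have := smul_mem' r⁻¹ (by positivity) _ h
    rwa [sub_zero, smul_smul, inv_mul_cancel₀ hr.ne', one_smul] at this
  -- The Archimedean property leaves room: a shift of `h` by `ε w` is still outside, which later
  -- yields the strict bound `g h ≤ -ε`.
  obtain ⟨ε, hε, hεK⟩ : ∃ ε : ℝ, 0 < ε ∧ ε • w + h ∉ K := by
    by_contra! hc
    exact hK (archimedean h hh fun r hr => by simpa using hc r hr)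
  -- multiples of the unit in the enlarged cone are nonnegative
  have key : ∀ k ∈ K, ∀ c t : ℝ, 0 ≤ c → t • w = k - c • (ε • w + h) → 0 ≤ t := by
    intro k hk c t hc hEq
    by_contra! ht
    rcases hc.eq_or_lt with rfl | hc
    · obtain ⟨r, hr, hrK⟩ := order_unit' (-h) hh.neg
      apply hεK
      rcases le_total r ε with hle | hle
      · have := add_mem _ hrK _ (smul_mem' (ε - r) (by linarith) _ w_mem)
        convert this using 1
        module
      · have hk' : k = t • w := by rw [hEq]; simp
        have := add_mem _ hrK _
          (smul_mem' ((r - ε) / (-t)) (div_nonneg (by linarith) (by linarith)) _ hk)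
        convert this using 1
        rw [hk', smul_smul, show (r - ε) / (-t) * t = -(r - ε) by
          have := ht.ne
          field_simp]
        module
    · apply hεK
      have hk' : k = t • w + c • (ε • w + h) := by rw [hEq]; abel
      have h1 := smul_mem' c⁻¹ (by positivity) _
        (add_mem _ hk _ (smul_mem' (-t) (by linarith) _ w_mem))
      have h2 : c⁻¹ • (k + (-t) • w) = ε • w + h := by
        rw [hk', show t • w + c • (ε • w + h) + (-t) • w = c • (ε • w + h) by module, smul_smul,
          inv_mul_cancel₀ hc.ne', one_smul]
      rwa [h2] at h1
  have w_ne : w ≠ 0 := by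
    rintro rfl
    have := key 0 zero_mem 0 (-1) le_rfl (by simp)
    linarith
  -- Testing `x + star x` instead of `x` makes skew elements lie in `S` with both signs, so the
  -- extended functional kills them. Subtracting multiples of `ε w + h` forces it to be nonpositive
  -- on that element.
  let S : PointedCone ℝ M :=
    { carrier := {x | ∃ k ∈ K, ∃ c : ℝ, 0 ≤ c ∧ x + star x = k - c • (ε • w + h)}
      add_mem' := by
        rintro x y ⟨k, hk, c, hc, hx⟩ ⟨k', hk', c', hc', hy⟩
        refine ⟨k + k', add_mem _ hk _ hk', c + c', by positivity, ?_⟩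
        rw [star_add, show x + y + (star x + star y) = x + star x + (y + star y) by abel, hx, hy]
        module
      zero_mem' := ⟨0, zero_mem, 0, le_rfl, by simp⟩
      smul_mem' := by
        rintro ⟨r, hr⟩ x ⟨k, hk, c, hc, hx⟩
        refine ⟨r • k, smul_mem' r hr _ hk, r * c, by positivity, ?_⟩
        change r • x + star (r • x) = _
        rw [star_smul, star_trivial, ← smul_add, hx, smul_sub, smul_smul] }
  have mem_S : ∀ x, (∃ k ∈ K, ∃ c : ℝ, 0 ≤ c ∧ x + star x = k - c • (ε • w + h)) → x ∈ S :=
    fun x hx => hx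
  obtain ⟨g, hg, hgS⟩ := riesz_extension S
    (LinearPMap.mkSpanSingleton (σ := RingHom.id ℝ) w (1 : ℝ) w_ne)
    (by
      rintro ⟨x, hx⟩ hxS
      obtain ⟨t, rfl⟩ := Submodule.mem_span_singleton.1 hx
      obtain ⟨k, hk, c, hc, hEq⟩ := hxS
      rw [LinearPMap.mkSpanSingleton'_apply]
      simp only at hEq
      rw [star_smul, star_trivial, hw.star_eq, ← add_smul] at hEq
      have := key k hk c _ hc hEq
      simp
      linarith)
    (by
      intro y
      obtain ⟨r, hr, hrK⟩ := order_unit' (-(y + star y)) (IsSelfAdjoint.add_star_self y).neg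
      refine ⟨⟨(r / 2) • w, Submodule.smul_mem _ _ (Submodule.mem_span_singleton_self w)⟩, ?_⟩
      refine mem_S _ ⟨_, hrK, 0, le_rfl, ?_⟩
      simp only [star_add, star_smul, star_trivial, hw.star_eq]
      module)
  have g_w : g w = 1 := by
    have := hg ⟨w, Submodule.mem_span_singleton_self w⟩
    rw [this]
    exact LinearPMap.mkSpanSingleton_apply ℝ ℝ w_ne 1
  have g_skew : ∀ x, x + star x = 0 → g x = 0 := by
    intro x hx
    apply le_antisymm
    · have := hgS (-x) (mem_S _ ⟨0, zero_mem, 0, le_rfl, by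
        rw [star_neg, ← neg_add, hx]; simp⟩)
      simpa using this
    · exact hgS x (mem_S _ ⟨0, zero_mem, 0, le_rfl, by rw [hx]; simp⟩)
  have g_K : ∀ x ∈ K, 0 ≤ g x := fun x hx => hgS x (mem_S _ ⟨(2 : ℝ) • x,
    smul_mem' 2 (by norm_num) _ hx, 0, le_rfl, by rw [(isSelfAdjoint x hx).star_eq]; module⟩)
  have g_h : g h < 0 := by
    have := hgS (-(ε • w + h)) (mem_S _ ⟨0, zero_mem, 2, by norm_num, by
      rw [star_neg, star_add, star_smul, star_trivial, hw.star_eq, hh.star_eq]; module⟩)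
    rw [map_neg, map_add, map_smul, g_w, smul_eq_mul] at this
    linarith
  have g_star : ∀ x, g (star x) = g x := fun x => by
    have := g_skew (x - star x) (by rw [star_sub, star_star]; abel)
    rw [map_sub] at this
    linarith
  have g_I_star : ∀ x, g (Complex.I • star x) = - g (Complex.I • x) := fun x => by
    have := g_star (Complex.I • x)
    rw [star_smul] at this
    rw [← this]
    simp
  -- The complexification is `g x - i g (i x)`; it is real on self-adjoint `x`, since `i x` is skew.
  let s : M →ₗ[ℂ] ℂ := Module.Dual.extendRCLike (𝕜 := ℂ) g
  have hs : ∀ x, s x = (g x : ℂ) - Complex.I * (g (Complex.I • x) : ℂ) := fun x => by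
    simpa using Module.Dual.extendRCLike_apply (𝕜 := ℂ) g x
  have hs_sa : ∀ x, IsSelfAdjoint x → s x = (g x : ℂ) := fun x hx => by
    have := g_skew (Complex.I • x) (by rw [star_smul, hx.star_eq]; simp)
    rw [hs, this]; simp
  refine ⟨s, fun x => ?_, fun x hx => ?_, ?_⟩
  · rw [hs, hs, g_star, g_I_star]
    apply Complex.ext <;> simp
  · rw [hs_sa x (isSelfAdjoint x hx)]
    exact_mod_cast g_K x hx
  · rw [hs_sa h hh]
    intro hc
    have : (0 : ℝ) ≤ g h := by exact_mod_cast hc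
    linarith

/-! ### Completely positive forms and the GNS construction -/

/-- The Hilbert space obtained from a positive semidefinite form by separation and completion,
and the operators given by the bounded sesquilinear forms. -/
theorem PreInnerProductSpace.Core.exists_hilbert {E : Type u} [AddCommGroup E] [Module ℂ E]
    (c : PreInnerProductSpace.Core ℂ E) :
    ∃ (H : Type u) (_ : NormedAddCommGroup H) (_ : InnerProductSpace ℂ H) (_ : CompleteSpace H)
      (ι : E → H), DenseRange ι ∧ (∀ u v, inner ℂ (ι u) (ι v) = c.inner u v) ∧
      ∀ f : E →ₗ⋆[ℂ] E →ₗ[ℂ] ℂ, (∃ K : ℝ, ∀ u v, ‖f u v‖ ≤ K * ‖ι u‖ * ‖ι v‖) →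
        ∃ T : H →L[ℂ] H, ∀ u v, inner ℂ (ι u) (T (ι v)) = f u v := by
  let : SeminormedAddCommGroup E := InnerProductSpace.Core.toSeminormedAddCommGroup (𝕜 := ℂ)
  let : InnerProductSpace ℂ E := InnerProductSpace.ofCore c
  let H := UniformSpace.Completion E
  let j : E →L[ℂ] H := UniformSpace.Completion.toComplL
  have hj : DenseRange j := UniformSpace.Completion.denseRange_coe
  have hji : IsUniformInducing j := UniformSpace.Completion.isUniformInducing_coe E
  refine ⟨H, inferInstance, inferInstance, inferInstance, fun u => (u : H), hj, fun u v => ?_, ?_⟩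
  · exact UniformSpace.Completion.inner_coe u v
  · rintro f ⟨K, hK⟩
    have hK' : ∀ u v, ‖f u v‖ ≤ K * ‖u‖ * ‖v‖ := fun u v => by
      have h : ∀ w : E, ‖(w : H)‖ = ‖w‖ := UniformSpace.Completion.norm_coe
      have := hK u v
      simp only [h] at this
      exact this
    -- The bounded form is extended to the completion one variable at a time; Riesz representation
    -- then gives an operator in the first slot, and its adjoint moves it to the second.
    let F : E →L⋆[ℂ] E →L[ℂ] ℂ := f.mkContinuous₂ K hK'
    let F1 : H →L⋆[ℂ] E →L[ℂ] ℂ := F.extend j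
    let F2 : H →L[ℂ] H →L⋆[ℂ] ℂ := F1.flip.extend j
    let T := InnerProductSpace.continuousLinearMapOfBilin (𝕜 := ℂ) F2.flip
    have hF : ∀ u v : E, F2.flip (j u) (j v) = f u v := fun u v => by
      simp only [ContinuousLinearMap.flip_apply, F2]
      rw [ContinuousLinearMap.extend_eq _ hj hji]
      simp only [ContinuousLinearMap.flip_apply, F1]
      rw [ContinuousLinearMap.extend_eq _ hj hji]
      rfl
    refine ⟨ContinuousLinearMap.adjoint T, fun u v => ?_⟩
    rw [ContinuousLinearMap.adjoint_inner_right]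
    change inner ℂ (T (j u)) (j v) = _
    rw [InnerProductSpace.continuousLinearMapOfBilin_apply, hF]

/-- A completely positive map `b` from `V` to the sesquilinear forms on `E`. -/
structure IsCPForm {V E : Type*} [AddCommGroup V] [Module ℂ V] [StarAddMonoid V]
    [StarModule ℂ V] [AddCommGroup E] [Module ℂ E] (C : MatrixCones V) (b : V → E → E → ℂ) :
    Prop where
  map_add : ∀ x y u v, b (x + y) u v = b x u v + b y u v
  map_smul : ∀ (c : ℂ) x u v, b (c • x) u v = c * b x u v
  map_star : ∀ x u v, b (star x) v u = star (b x u v)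
  add_right : ∀ x u v w, b x u (v + w) = b x u v + b x u w
  smul_right : ∀ (c : ℂ) x u v, b x u (c • v) = c * b x u v
  nonneg : ∀ n, ∀ x ∈ C n, ∀ u : Fin n → E, 0 ≤ ∑ i, ∑ j, b (x i j) (u i) (u j)

namespace IsCPForm

variable {V : Type*} {E : Type u} [AddCommGroup V] [Module ℂ V] [StarAddMonoid V]
  [StarModule ℂ V] [AddCommGroup E] [Module ℂ E] {C : MatrixCones V} {b : V → E → E → ℂ}

theorem add_left (hb : IsCPForm C b) (x : V) (u v w : E) :
    b x (u + v) w = b x u w + b x v w := by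
  have h := fun u => hb.map_star (star x) w u
  simp only [star_star] at h
  rw [h, h, h, hb.add_right, star_add]

theorem smul_left (hb : IsCPForm C b) (c : ℂ) (x : V) (u v : E) :
    b x (c • u) v = star c * b x u v := by
  have h := fun u => hb.map_star (star x) v u
  simp only [star_star] at h
  rw [h, h, hb.smul_right, star_mul, mul_comm]

theorem nonneg_self (hb : IsCPForm C b) {x : V} (hx : IsPos C x) (u : E) : 0 ≤ b x u u := by
  simpa using hb.nonneg 1 _ hx fun _ => u

/-- The semi-inner product on `E` given by a positive element of `V`. -/
@[reducible]
def core (hb : IsCPForm C b) {x : V} (hx : IsPos C x) (hsa : IsSelfAdjoint x) :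
    PreInnerProductSpace.Core ℂ E where
  inner := b x
  conj_inner_symm u v := by
    have := hb.map_star x v u
    rw [hsa.star_eq] at this
    exact this.symm
  re_inner_nonneg u := (Complex.nonneg_iff.1 (hb.nonneg_self hx u)).1
  add_left := hb.add_left x
  smul_left u v c := hb.smul_left c x u v

theorem norm_sq_le (hb : IsCPForm C b) {x : V} (hx : IsPos C x) (hsa : IsSelfAdjoint x) (u v : E) :
    ‖b x u v‖ ^ 2 ≤ (b x u u).re * (b x v v).re := by
  have h := @InnerProductSpace.Core.inner_mul_inner_self_le ℂ E _ _ _ (hb.core hx hsa) u v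
  have h2 : ‖b x v u‖ = ‖b x u v‖ := by
    have := hb.map_star x u v
    rw [hsa.star_eq] at this
    rw [this, norm_star]
  rw [sq]
  nth_rewrite 2 [← h2]
  exact h

/-- By Cauchy–Schwarz, null vectors of a positive form lie in its radical. -/
theorem eq_zero_of_self_eq_zero (hb : IsCPForm C b) {x : V} (hx : IsPos C x)
    (hsa : IsSelfAdjoint x) {v : E} (hv : b x v v = 0) (u : E) : b x u v = 0 := by
  have := hb.norm_sq_le hx hsa u v
  rw [hv] at this
  simpa using this

/-- The sesquilinear form given by an element of `V`. -/
def form (hb : IsCPForm C b) (x : V) : E →ₗ⋆[ℂ] E →ₗ[ℂ] ℂ :=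
  LinearMap.mk₂'ₛₗ (starRingEnd ℂ) (RingHom.id ℂ) (b x) (fun u v w => hb.add_left x u v w)
    (fun c u v => hb.smul_left c x u v) (fun u v w => hb.add_right x u v w)
    (fun c u v => hb.smul_right c x u v)

end IsCPForm

theorem IsMatrixOrdering.isSelfAdjoint_of_isPos {V : Type*} [AddCommGroup V] [Module ℂ V]
    [StarAddMonoid V] [StarModule ℂ V] {C : MatrixCones V} (hC : IsMatrixOrdering C) {x : V} (hx : IsPos C x) :
    IsSelfAdjoint x := by
  have := congrFun (congrFun (hC.isHermitian 1 _ hx) 0) 0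
  simpa [IsSelfAdjoint] using this

theorem IsMatrixOrdering.isPos_smul {V : Type*} [AddCommGroup V] [Module ℂ V] [StarAddMonoid V]
    [StarModule ℂ V] {C : MatrixCones V} (hC : IsMatrixOrdering C) {r : ℝ} (hr : 0 ≤ r) {x : V}
    (hx : IsPos C x) : IsPos C ((r : ℂ) • x) :=
  hC.smul_mem 1 r hr _ hx

namespace IsOperatorSystem

variable {V : Type*} {E : Type u} [AddCommGroup V] [Module ℂ V] [StarAddMonoid V]
  [StarModule ℂ V] {C : MatrixCones V} {e : V}

theorem exists_isPos_sub (hV : IsOperatorSystem C e) {x : V} (hx : IsSelfAdjoint x) :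
    ∃ r : ℝ, 0 < r ∧ IsPos C ((r : ℂ) • e - x) := by
  obtain ⟨r, hr, h⟩ := hV.matrix_order_unit 1 (Matrix.of fun _ _ => x) (by
    ext i j; simpa using hx.star_eq)
  refine ⟨r, hr, ?_⟩
  unfold IsPos
  convert h using 1
  ext i j
  simp [amp, Subsingleton.elim i j]

theorem isPos_unit (hV : IsOperatorSystem C e) : IsPos C e := by
  obtain ⟨r, hr, h⟩ := hV.exists_isPos_sub (IsSelfAdjoint.zero V)
  have := hV.isPos_smul (inv_nonneg.2 hr.le) h
  rw [sub_zero, smul_smul, ← Complex.ofReal_mul, inv_mul_cancel₀ hr.ne'] at this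
  simpa using this

/-- The forms of a completely positive map are bounded in the semi-norm given by the unit. -/
theorem exists_bound (hV : IsOperatorSystem C e) [AddCommGroup E] [Module ℂ E]
    {b : V → E → E → ℂ} (hb : IsCPForm C b) (x : V) :
    ∃ K : ℝ, ∀ u v, ‖b x u v‖ ≤ K * √(b e u u).re * √(b e v v).re := by
  have add {x y : V} (hx : ∃ K : ℝ, ∀ u v, ‖b x u v‖ ≤ K * √(b e u u).re * √(b e v v).re)
      (hy : ∃ K : ℝ, ∀ u v, ‖b y u v‖ ≤ K * √(b e u u).re * √(b e v v).re) :
      ∃ K : ℝ, ∀ u v, ‖b (x + y) u v‖ ≤ K * √(b e u u).re * √(b e v v).re := by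
    obtain ⟨K, hK⟩ := hx
    obtain ⟨L, hL⟩ := hy
    refine ⟨K + L, fun u v => ?_⟩
    rw [hb.map_add, add_mul, add_mul]
    exact (norm_add_le _ _).trans (add_le_add (hK u v) (hL u v))
  have smul (c : ℂ) {x : V} (hx : ∃ K : ℝ, ∀ u v, ‖b x u v‖ ≤ K * √(b e u u).re * √(b e v v).re) :
      ∃ K : ℝ, ∀ u v, ‖b (c • x) u v‖ ≤ K * √(b e u u).re * √(b e v v).re := by
    obtain ⟨K, hK⟩ := hx
    refine ⟨‖c‖ * K, fun u v => ?_⟩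
    rw [hb.map_smul, norm_mul, mul_assoc, mul_assoc, ← mul_assoc K]
    exact mul_le_mul_of_nonneg_left (hK u v) (norm_nonneg c)
  -- For `0 ≤ x ≤ r e`, Cauchy–Schwarz for `b x` followed by `b x ≤ r b e` on the diagonal gives the
  -- constant `r`.
  have pos {x : V} (hx : IsPos C x) :
      ∃ K : ℝ, ∀ u v, ‖b x u v‖ ≤ K * √(b e u u).re * √(b e v v).re := by
    have hsa := hV.isSelfAdjoint_of_isPos hx
    obtain ⟨r, hr, hrx⟩ := hV.exists_isPos_sub hsa
    refine ⟨r, fun u v => ?_⟩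
    have le : ∀ w, (b x w w).re ≤ r * (b e w w).re := fun w => by
      have := (Complex.nonneg_iff.1 (hb.nonneg_self hrx w)).1
      rw [sub_eq_add_neg, ← neg_one_smul ℂ x, hb.map_add, hb.map_smul, hb.map_smul] at this
      simp at this
      linarith
    have nn : ∀ w, 0 ≤ (b x w w).re := fun w => (Complex.nonneg_iff.1 (hb.nonneg_self hx w)).1
    have ne : ∀ w, 0 ≤ (b e w w).re := fun w =>
      (Complex.nonneg_iff.1 (hb.nonneg_self hV.isPos_unit w)).1
    refine abs_le_of_sq_le_sq' ?_ (by positivity) |>.2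
    calc ‖b x u v‖ ^ 2 ≤ (b x u u).re * (b x v v).re := hb.norm_sq_le hx hsa u v
      _ ≤ (r * (b e u u).re) * (r * (b e v v).re) :=
        mul_le_mul (le u) (le v) (nn v) (mul_nonneg hr.le (ne u))
      _ = (r * √(b e u u).re * √(b e v v).re) ^ 2 := by
        rw [mul_pow, mul_pow, Real.sq_sqrt (ne u), Real.sq_sqrt (ne v)]; ring
  -- A self-adjoint `x` is the difference of the positive elements `r e` and `r e - x`.
  have sa {x : V} (hx : IsSelfAdjoint x) :
      ∃ K : ℝ, ∀ u v, ‖b x u v‖ ≤ K * √(b e u u).re * √(b e v v).re := by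
    obtain ⟨r, -, h⟩ := hV.exists_isPos_sub hx
    have := add (smul (r : ℂ) (pos hV.isPos_unit)) (smul (-1) (pos h))
    rwa [show (r : ℂ) • e + (-1 : ℂ) • ((r : ℂ) • e - x) = x by module] at this
  rw [← realPart_add_I_smul_imaginaryPart x]
  exact add (sa (realPart x).2) (smul _ (sa (imaginaryPart x).2))

/-- Dilation of a completely positive map into sesquilinear forms to a unital map into `B(H)`. -/
theorem exists_hilbert (hV : IsOperatorSystem C e) [AddCommGroup E] [Module ℂ E]
    {b : V → E → E → ℂ} (hb : IsCPForm C b) :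
    ∃ (H : Type u) (_ : NormedAddCommGroup H) (_ : InnerProductSpace ℂ H) (_ : CompleteSpace H)
      (ι : E → H) (π : V →ₗ[ℂ] (H →L[ℂ] H)), DenseRange ι ∧ π e = 1 ∧
      (∀ u v, inner ℂ (ι u) (ι v) = b e u v) ∧
      ∀ x u v, inner ℂ (ι u) (π x (ι v)) = b x u v := by
  obtain ⟨H, _, _, _, ι, hι, hinner, hT⟩ :=
    (hb.core hV.isPos_unit hV.unit_isSelfAdjoint).exists_hilbert
  have hinner' : ∀ u v, inner ℂ (ι u) (ι v) = b e u v := hinner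
  have hnorm : ∀ u, √(b e u u).re = ‖ι u‖ := fun u => by
    rw [← hinner', norm_eq_sqrt_re_inner (𝕜 := ℂ)]; rfl
  have hex : ∀ x, ∃ T : H →L[ℂ] H, ∀ u v, inner ℂ (ι u) (T (ι v)) = b x u v := fun x => by
    obtain ⟨K, hK⟩ := hV.exists_bound hb x
    exact hT (hb.form x) ⟨K, fun u v => by
      have := hK u v
      rwa [hnorm, hnorm] at this⟩
  choose T hT using hex
  have ext {S S' : H →L[ℂ] H}
      (h : ∀ u v, inner ℂ (ι u) (S (ι v)) = inner ℂ (ι u) (S' (ι v))) : S = S' := by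
    refine ContinuousLinearMap.coeFn_injective
      (hι.equalizer S.continuous S'.continuous (funext fun v => ?_))
    exact hι.eq_of_inner_right (𝕜 := ℂ) fun u => h u v
  refine ⟨H, _, _, inferInstance, ι,
    { toFun := T, map_add' := fun x y => ext fun u v => ?_,
      map_smul' := fun c x => ext fun u v => ?_ },
    hι, ext fun u v => ?_, hinner', hT⟩
  · simp [hT, hb.map_add]
  · simp [hT, hb.map_smul]
  · simp [hT, hinner']

end IsOperatorSystem

theorem mem_operatorCones_iff {H : Type*} [NormedAddCommGroup H] [InnerProductSpace ℂ H]
    [CompleteSpace H] {n : ℕ} (x : Matrix (Fin n) (Fin n) (H →L[ℂ] H)) :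
    x ∈ operatorCones H n ↔ ∀ h : Fin n → H, 0 ≤ ∑ i, ∑ j, inner ℂ (h i) (x i j (h j)) := by
  have key : ∀ h : PiLp 2 (fun _ : Fin n => H),
      inner ℂ h (blockOperator x h) = ∑ i, ∑ j, inner ℂ (h i) (x i j (h j)) := fun h => by
    simp [blockOperator, PiLp.inner_apply, inner_sum]
  change (blockOperator x).IsPositive ↔ _
  constructor
  · intro hx h
    have := hx.inner_nonneg_right (WithLp.toLp 2 h)
    rwa [key] at this
  · intro hx
    -- Over `ℂ` a real quadratic form already forces self-adjointness, and the order on `ℂ` includes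
    -- reality.
    rw [ContinuousLinearMap.isPositive_iff_complex]
    intro h
    have h1 := hx h
    rw [← key, ← inner_conj_symm] at h1
    have h2 : 0 ≤ inner ℂ (blockOperator x h) h := by
      have := star_nonneg_iff.2 h1
      simpa using this
    obtain ⟨hre, him⟩ := Complex.nonneg_iff.1 h2
    exact ⟨Complex.ext (by simp) (by simpa using him), hre⟩

/-! ### Embeddings from forms that detect positivity -/

namespace IsCPForm

variable {V : Type*} {E : Type u} [AddCommGroup V] [Module ℂ V] [StarAddMonoid V]
  [StarModule ℂ V] [AddCommGroup E] [Module ℂ E] {C : MatrixCones V} {b : V → E → E → ℂ} {e : V}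

/-- Hermiticity comes for free: the form of the imaginary part of `x` vanishes, so both signs of
that part lie in the cone, and properness makes it zero. -/
theorem mem_of_nonneg (hb : IsCPForm C b) (hV : IsOperatorSystem C e)
    (hsep : ∀ n (x : Matrix (Fin n) (Fin n) V), x.IsHermitian →
      (∀ u : Fin n → E, 0 ≤ ∑ i, ∑ j, b (x i j) (u i) (u j)) → x ∈ C n)
    {n : ℕ} (x : Matrix (Fin n) (Fin n) V)
    (hx : ∀ u : Fin n → E, 0 ≤ ∑ i, ∑ j, b (x i j) (u i) (u j)) : x ∈ C n := by
  have real : ∀ y : Matrix (Fin n) (Fin n) V, IsSelfAdjoint y → ∀ u : Fin n → E,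
      (∑ i, ∑ j, b (y i j) (u i) (u j)).im = 0 := by
    intro y hy u
    rw [← Complex.conj_eq_iff_im]
    calc _ = ∑ i, ∑ j, star (b (y i j) (u i) (u j)) := by simp [map_sum]
      _ = ∑ i, ∑ j, b (y j i) (u j) (u i) := by
        refine Finset.sum_congr rfl fun i _ => Finset.sum_congr rfl fun j _ => ?_
        rw [← hb.map_star]
        congr 1
        exact congrFun (congrFun hy.star_eq j) i
      _ = _ := Finset.sum_comm
  set h := (realPart x : Matrix (Fin n) (Fin n) V)
  set k := (imaginaryPart x : Matrix (Fin n) (Fin n) V) with hk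
  have hsum : ∀ u : Fin n → E, ∑ i, ∑ j, b (x i j) (u i) (u j) =
      ∑ i, ∑ j, b (h i j) (u i) (u j) + Complex.I * ∑ i, ∑ j, b (k i j) (u i) (u j) := by
    intro u
    simp only [Finset.mul_sum, ← Finset.sum_add_distrib]
    refine Finset.sum_congr rfl fun i _ => Finset.sum_congr rfl fun j _ => ?_
    rw [← hb.map_smul, ← hb.map_add]
    congr 1
    exact congrFun (congrFun (realPart_add_I_smul_imaginaryPart x).symm i) j
  have kzero : ∀ u : Fin n → E, ∑ i, ∑ j, b (k i j) (u i) (u j) = 0 := by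
    intro u
    have h1 := real h (realPart x).2 u
    have h2 := real k (imaginaryPart x).2 u
    have h3 := (Complex.nonneg_iff.1 (hx u)).2
    rw [hsum] at h3
    apply Complex.ext
    · simpa [h1, h2] using h3.symm
    · exact h2
  have hk0 : k = 0 := by
    refine hV.proper n k (hsep n k (imaginaryPart x).2 fun u => (kzero u).ge)
      (hsep n (-k) (IsSelfAdjoint.neg (imaginaryPart x).2) fun u => ?_)
    have : ∀ i j, b ((-k) i j) (u i) (u j) = - b (k i j) (u i) (u j) := fun i j => by
      rw [Matrix.neg_apply, ← neg_one_smul ℂ (k i j), hb.map_smul, neg_one_mul]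
    simp only [this, Finset.sum_neg_distrib, kzero, neg_zero, le_refl]
  have hxh : x = h := by
    have := realPart_add_I_smul_imaginaryPart x
    rw [← hk, hk0, smul_zero, add_zero] at this
    exact this.symm
  exact hsep n x (hxh ▸ (realPart x).2) hx

/-- A completely positive form which detects positivity yields a unital complete order embedding
into `B(H)`; an element whose form is given by an idempotent is sent to a projection. -/
theorem exists_embedding (hb : IsCPForm C b) (hV : IsOperatorSystem C e)
    (hsep : ∀ n (x : Matrix (Fin n) (Fin n) V), x.IsHermitian →
      (∀ u : Fin n → E, 0 ≤ ∑ i, ∑ j, b (x i j) (u i) (u j)) → x ∈ C n)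
    {p : V} (hp : IsPos C p) (P : E → E) (hP : ∀ v, P (P v) = P v)
    (hbp : ∀ u v, b p u v = b e u (P v)) :
    ∃ (H : Type u) (_ : NormedAddCommGroup H) (_ : InnerProductSpace ℂ H) (_ : CompleteSpace H)
      (π : V →ₗ[ℂ] (H →L[ℂ] H)),
      π e = 1 ∧ IsCompleteOrderEmbedding C (operatorCones H) π ∧ IsStarProjection (π p) := by
  obtain ⟨H, _, _, _, ι, π, hι, hπe, hι', hπ⟩ := hV.exists_hilbert hb
  have map_mem : ∀ (n : ℕ) (x : Matrix (Fin n) (Fin n) V), x ∈ C n →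
      x.map π ∈ operatorCones H n := by
    intro n x hx
    rw [mem_operatorCones_iff]
    intro h
    -- Positivity is a closed condition, so vectors from the dense range of `ι` suffice.
    refine (DenseRange.piMap fun _ : Fin n => hι).induction_on
      (p := fun h => 0 ≤ ∑ i, ∑ j, inner ℂ (h i) ((x.map π) i j (h j))) h
      (isClosed_le continuous_const (by fun_prop)) fun u => ?_
    simpa [Pi.map, hπ] using hb.nonneg n x hx u
  refine ⟨H, _, _, inferInstance, π, hπe, ⟨?_, map_mem, ?_⟩, ?_, ?_⟩
  · rw [injective_iff_map_eq_zero]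
    intro x hx
    have hx0 : ∀ u v, b x u v = 0 := fun u v => by rw [← hπ, hx]; simp
    have h1 := hb.mem_of_nonneg hV hsep (n := 1) (Matrix.of fun _ _ => x) (by simp [hx0])
    have h2 := hb.mem_of_nonneg hV hsep (n := 1) (-Matrix.of fun _ _ => x) fun u => by
      have : ∀ u v, b (-x) u v = 0 := fun u v => by
        rw [← neg_one_smul ℂ, hb.map_smul, hx0, mul_zero]
      simp [this]
    simpa using congrFun (congrFun (hV.proper 1 _ h1 h2) 0) 0
  · intro n x hx
    refine hb.mem_of_nonneg hV hsep x fun u => ?_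
    have := (mem_operatorCones_iff _).1 hx fun i => ι (u i)
    simpa [hπ] using this
  · have hPι : ∀ v, π p (ι v) = ι (P v) := fun v =>
      hι.eq_of_inner_right (𝕜 := ℂ) fun u => by rw [hπ, hι', hbp]
    refine ContinuousLinearMap.coeFn_injective
      (hι.equalizer (ContinuousLinearMap.continuous _) (ContinuousLinearMap.continuous _)
        (funext fun v => ?_))
    simp [hPι, hP]
  · have h1 := (mem_operatorCones_iff _).1 (map_mem 1 _ hp)
    refine ContinuousLinearMap.IsPositive.isSelfAdjoint ?_
    rw [ContinuousLinearMap.isPositive_iff_complex]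
    intro h
    have h2 := h1 fun _ => h
    simp only [Finset.univ_unique, Finset.sum_singleton, Matrix.map_apply, Matrix.of_apply] at h2
    rw [← inner_conj_symm] at h2
    obtain ⟨hre, him⟩ := Complex.nonneg_iff.1 (star_nonneg_iff.2 h2)
    rw [← starRingEnd_apply, Complex.conj_conj] at hre him
    exact ⟨Complex.ext (by simp) (by simpa using him), hre⟩

end IsCPForm

/-! ### Direct sums of forms -/

/-- The orthogonal direct sum of a family of form-valued maps. -/
noncomputable def directSumForm {V I : Type*} {E : I → Type*} [∀ i, AddCommGroup (E i)]
    (b : ∀ i, V → E i → E i → ℂ) (x : V) (u v : Π₀ i, E i) : ℂ :=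
  ∑ᶠ i, b i x (u i) (v i)

theorem IsCPForm.directSum {V : Type*} [AddCommGroup V] [Module ℂ V] [StarAddMonoid V]
    [StarModule ℂ V] {C : MatrixCones V} {I : Type*} {E : I → Type*} [∀ i, AddCommGroup (E i)]
    [∀ i, Module ℂ (E i)] {b : ∀ i, V → E i → E i → ℂ} (hb : ∀ i, IsCPForm C (b i)) :
    IsCPForm C (directSumForm b) := by
  classical
  have fin : ∀ (x : V) (u v : Π₀ i, E i), (fun i => b i x (u i) (v i)).HasFiniteSupport := by
    intro x u v
    refine (v.support.finite_toSet).subset fun i hi => ?_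
    simp only [Finset.mem_coe, DFinsupp.mem_support_iff]
    intro h0
    apply hi
    have := (hb i).smul_right 0 x (u i) 0
    simpa [h0] using this
  refine ⟨fun x y u v => ?_, fun c x u v => ?_, fun x u v => ?_, fun x u v w => ?_,
    fun c x u v => ?_, fun n x hx u => ?_⟩
  · simp only [directSumForm, (hb _).map_add]
    exact finsum_add_distrib (fin x u v) (fin y u v)
  · simp only [directSumForm, (hb _).map_smul]
    exact (smul_finsum c _).symm
  · simp only [directSumForm, (hb _).map_star]
    exact ((starAddEquiv : ℂ ≃+ ℂ).toAddMonoidHom.map_finsum (fin x u v)).symm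
  · simp only [directSumForm, DFinsupp.add_apply, (hb _).add_right]
    exact finsum_add_distrib (fin x u v) (fin x u w)
  · simp only [directSumForm, DFinsupp.smul_apply, (hb _).smul_right]
    exact (smul_finsum c _).symm
  · have h : ∑ i, ∑ j, directSumForm b (x i j) (u i) (u j) =
        ∑ᶠ k, ∑ i, ∑ j, b k (x i j) (u i k) (u j k) := by
      have h1 : ∀ i, ∑ j, directSumForm b (x i j) (u i) (u j) =
          ∑ᶠ k, ∑ j, b k (x i j) (u i k) (u j k) := fun i =>
        (finsum_sum_comm Finset.univ (fun k j => b k (x i j) (u i k) (u j k))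
          fun j _ => fin _ _ _).symm
      simp only [h1]
      refine (finsum_sum_comm Finset.univ (fun k i => ∑ j, b k (x i j) (u i k) (u j k))
        fun i _ => ?_).symm
      -- The support of a finite sum lies in the union of the supports of its terms.
      refine (Set.Finite.biUnion Finset.univ.finite_toSet
        fun j _ => fin (x i j) (u i) (u j)).subset fun k hk => ?_
      by_contra hc
      apply hk
      simp only [Set.mem_iUnion, not_exists] at hc
      exact Finset.sum_eq_zero fun j _ => by simpa using hc j (by simp)
    rw [h]
    exact finsum_nonneg fun k => (hb k).nonneg n x hx fun i => u i k

/-! ### Rank-one tensors and the cones of `M_2(V)` -/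

/-- The element `ξ* η ⊗ x` of `M_n(M_2(V))`. -/
def rankOneTensor {V : Type*} [AddCommGroup V] [Module ℂ V] {n : ℕ} (ξ η : Fin n → Fin 2 → ℂ)
    (x : V) : Matrix (Fin n) (Fin n) (Matrix (Fin 2) (Fin 2) V) :=
  Matrix.of fun i j => Matrix.of fun k l => (star (ξ i k) * η j l) • x

/-- For positive `a` and `c` every summand is positive, so a positive functional that vanishes on
the total vanishes on each of them. -/
theorem amp_diagPair {V : Type*} [AddCommGroup V] [Module ℂ V] {n : ℕ} (a c : V) :
    amp n (diagPair a c) =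
    ∑ i, rankOneTensor (Pi.single i (Pi.single 0 1)) (Pi.single i (Pi.single 0 1)) a +
    ∑ i, rankOneTensor (Pi.single i (Pi.single 1 1)) (Pi.single i (Pi.single 1 1)) c := by
  ext i j k l
  simp only [amp, Matrix.diagonal_apply, diagPair, Matrix.add_apply, Matrix.sum_apply,
    rankOneTensor, Matrix.of_apply, Pi.single_apply]
  by_cases hij : i = j
  · subst hij
    fin_cases k <;> fin_cases l <;> simp [ite_apply, apply_ite]
  · fin_cases k <;> fin_cases l <;>
      simp [ite_apply, hij, apply_ite, Finset.sum_ite_eq]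

theorem amp_sub_diagPair {V : Type*} [AddCommGroup V] (e p : V) :
    amp 2 e - diagPair p (e - p) = diagPair (e - p) p := by
  ext k l
  fin_cases k <;> fin_cases l <;> simp [amp, diagPair]

section Cones

variable {V : Type*} [AddCommGroup V] [Module ℂ V] [StarAddMonoid V] [StarModule ℂ V]
  {C : MatrixCones V} {n : ℕ}

theorem matrixSystemCones_zero_mem (hC : IsMatrixOrdering C) : 0 ∈ matrixSystemCones C 2 n :=
  hC.zero_mem _

theorem matrixSystemCones_add_mem (hC : IsMatrixOrdering C)
    {x y : Matrix (Fin n) (Fin n) (Matrix (Fin 2) (Fin 2) V)} (hx : x ∈ matrixSystemCones C 2 n)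
    (hy : y ∈ matrixSystemCones C 2 n) : x + y ∈ matrixSystemCones C 2 n :=
  hC.add_mem _ _ hx _ hy

theorem matrixSystemCones_smul_mem (hC : IsMatrixOrdering C) {r : ℝ} (hr : 0 ≤ r)
    {x : Matrix (Fin n) (Fin n) (Matrix (Fin 2) (Fin 2) V)} (hx : x ∈ matrixSystemCones C 2 n) :
    (r : ℂ) • x ∈ matrixSystemCones C 2 n :=
  hC.smul_mem _ r hr _ hx

theorem matrixSystemCones_sum_mem (hC : IsMatrixOrdering C) {ι : Type*} (s : Finset ι)
    {x : ι → Matrix (Fin n) (Fin n) (Matrix (Fin 2) (Fin 2) V)}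
    (hx : ∀ i ∈ s, x i ∈ matrixSystemCones C 2 n) : ∑ i ∈ s, x i ∈ matrixSystemCones C 2 n :=
  Finset.sum_induction _ (· ∈ matrixSystemCones C 2 n)
    (fun _ _ => matrixSystemCones_add_mem hC) (matrixSystemCones_zero_mem hC) hx

theorem matrixSystemCones_isHermitian (hC : IsMatrixOrdering C)
    {x : Matrix (Fin n) (Fin n) (Matrix (Fin 2) (Fin 2) V)} (hx : x ∈ matrixSystemCones C 2 n) :
    x.IsHermitian := by
  have h := hC.isHermitian _ _ hx
  ext i j k l
  have := congrFun (congrFun h (finProdFinEquiv (i, k))) (finProdFinEquiv (j, l))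
  simpa using this

theorem matrixSystemCones_order_unit {e : V} (hV : IsOperatorSystem C e)
    {x : Matrix (Fin n) (Fin n) (Matrix (Fin 2) (Fin 2) V)} (hx : x.IsHermitian) :
    ∃ r : ℝ, 0 < r ∧ (r : ℂ) • amp n (amp 2 e) - x ∈ matrixSystemCones C 2 n := by
  obtain ⟨r, hr, h⟩ := hV.matrix_order_unit (n * 2) (Matrix.reindex finProdFinEquiv finProdFinEquiv
    (Matrix.comp (Fin n) (Fin n) (Fin 2) (Fin 2) V x)) (by
      ext i j
      have := congrFun (congrFun (congrFun (congrFun hx (finProdFinEquiv.symm i).1)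
        (finProdFinEquiv.symm j).1) (finProdFinEquiv.symm i).2) (finProdFinEquiv.symm j).2
      simpa using this)
  refine ⟨r, hr, ?_⟩
  change _ ∈ C (n * 2)
  convert h using 1
  ext i j
  obtain ⟨⟨i, k⟩, rfl⟩ := finProdFinEquiv.surjective i
  obtain ⟨⟨j, l⟩, rfl⟩ := finProdFinEquiv.surjective j
  simp only [amp, Matrix.reindex_apply, Matrix.submatrix_apply, Equiv.symm_apply_apply,
    Matrix.comp_apply, Matrix.sub_apply, Matrix.smul_apply, Matrix.diagonal_apply,
    EmbeddingLike.apply_eq_iff_eq, Prod.mk.injEq]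
  by_cases hij : i = j <;> by_cases hkl : k = l <;> simp [hij, hkl]

/-- The sum is `α* x α`, where row `a` of `α` lists the coordinates of `ξ a`. This is the source of
complete positivity of the forms. -/
theorem sum_rankOneTensor_mem (hC : IsMatrixOrdering C) {m : ℕ} {x : Matrix (Fin m) (Fin m) V}
    (hx : x ∈ C m) (ξ : Fin m → Fin n → Fin 2 → ℂ) :
    ∑ a, ∑ b, rankOneTensor (ξ a) (ξ b) (x a b) ∈ matrixSystemCones C 2 n := by
  have := hC.scalarConj_mem m (n * 2) (Matrix.of fun a c =>
    ξ a (finProdFinEquiv.symm c).1 (finProdFinEquiv.symm c).2) x hx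
  change _ ∈ C (n * 2)
  convert this using 1
  ext i j
  simp [scalarConj, rankOneTensor, Matrix.sum_apply]

theorem rankOneTensor_mem (hC : IsMatrixOrdering C) {x : V} (hx : IsPos C x)
    (ξ : Fin n → Fin 2 → ℂ) : rankOneTensor ξ ξ x ∈ matrixSystemCones C 2 n := by
  simpa using sum_rankOneTensor_mem hC hx fun _ => ξ

theorem amp_diagPair_mem (hC : IsMatrixOrdering C) {a c : V} (ha : IsPos C a) (hc : IsPos C c) :
    amp n (diagPair a c) ∈ matrixSystemCones C 2 n := by
  rw [amp_diagPair]
  exact matrixSystemCones_add_mem hC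
    (matrixSystemCones_sum_mem hC _ fun i _ => rankOneTensor_mem hC ha _)
    (matrixSystemCones_sum_mem hC _ fun i _ => rankOneTensor_mem hC hc _)

end Cones

/-! ### Cones relative to `p ⊕ q` and their positive functionals -/

/-- Positive hermitian linear functionals on a `*`-vector space, relative to a set `K` of
positive elements. -/
structure PositiveFunctional {M : Type*} [AddCommGroup M] [Module ℂ M] [Star M] (K : Set M) where
  toLinearMap : M →ₗ[ℂ] ℂ
  map_star : ∀ x, toLinearMap (star x) = star (toLinearMap x)
  nonneg : ∀ x ∈ K, 0 ≤ toLinearMap x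

/-- The cones relative to `p ⊕ q` on `M_2(V)`. -/
abbrev peirceCones {V : Type*} [AddCommGroup V] [Module ℂ V] [StarAddMonoid V] (C : MatrixCones V)
    (e p : V) : MatrixCones (Matrix (Fin 2) (Fin 2) V) :=
  relativeCones (matrixSystemCones C 2) (amp 2 e) (diagPair p (e - p))

/-- Here `1 : Fin 2 → ℂ` is the vector `(1, 1)`, so the vectors involved are `e_a ⊗ (1, 1)`. This
links the forms to `π_p`. -/
theorem sum_rankOneTensor_single {V : Type*} [AddCommGroup V] [Module ℂ V] {n : ℕ}
    (x : Matrix (Fin n) (Fin n) V) :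
    ∑ a, ∑ b, rankOneTensor (Pi.single a 1) (Pi.single b 1) (x a b) = x.map (constMatrix V) := by
  ext i j k l
  simp only [rankOneTensor, Matrix.sum_apply, Matrix.of_apply, Matrix.map_apply]
  fin_cases k <;> fin_cases l <;> simp [constMatrix, Pi.single_apply, ite_apply, apply_ite]

/-- The unit splits as `(p ⊕ q) + (q ⊕ p)`: a small multiple of the first part is absorbed into `ε`,
and the second into `t`. -/
theorem peirceCones_archimedean {V : Type*} [AddCommGroup V] [Module ℂ V] [StarAddMonoid V]
    {C : MatrixCones V} {n : ℕ} {e p : V} (x : Matrix (Fin n) (Fin n) (Matrix (Fin 2) (Fin 2) V))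
    (hx : IsSelfAdjoint x)
    (h : ∀ r : ℝ, 0 < r → (r : ℂ) • amp n (amp 2 e) + x ∈ peirceCones C e p n) :
    x ∈ peirceCones C e p n := by
  refine ⟨hx, fun ε hε => ?_⟩
  obtain ⟨t, ht, hxt⟩ := (h (ε / 2) (by positivity)).2 (ε / 2) (by positivity)
  refine ⟨ε / 2 + t, by positivity, ?_⟩
  convert hxt using 1
  have : amp n (amp 2 e - diagPair p (e - p)) = amp n (amp 2 e) - amp n (diagPair p (e - p)) := by
    simp [amp, Matrix.diagonal_sub]
  rw [this]
  push_cast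
  module

section Peirce

variable {V : Type*} [AddCommGroup V] [Module ℂ V] [StarAddMonoid V] [StarModule ℂ V]
  {C : MatrixCones V} {n : ℕ} {e p : V}

theorem mem_peirceCones_of_mem (hC : IsMatrixOrdering C) (hp : IsPos C p)
    (hq : IsPos C (e - p)) {x : Matrix (Fin n) (Fin n) (Matrix (Fin 2) (Fin 2) V)}
    (hx : x ∈ matrixSystemCones C 2 n) : x ∈ peirceCones C e p n := by
  refine ⟨matrixSystemCones_isHermitian hC hx, fun ε hε => ⟨1, one_pos, ?_⟩⟩
  rw [amp_sub_diagPair]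
  exact matrixSystemCones_add_mem hC (matrixSystemCones_add_mem hC hx
    (matrixSystemCones_smul_mem hC hε.le (amp_diagPair_mem hC hp hq)))
    (matrixSystemCones_smul_mem hC zero_le_one (amp_diagPair_mem hC hq hp))

/-- With `t = 1` the added term cancels the element exactly. This is what forces positive
functionals to vanish on `(q ⊕ p)_n`. -/
theorem neg_amp_mem_peirceCones (hC : IsMatrixOrdering C) (hp : IsPos C p)
    (hq : IsPos C (e - p)) : -amp n (diagPair (e - p) p) ∈ peirceCones C e p n := by
  refine ⟨(matrixSystemCones_isHermitian hC (amp_diagPair_mem hC hq hp)).neg,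
    fun ε hε => ⟨1, one_pos, ?_⟩⟩
  rw [amp_sub_diagPair]
  convert matrixSystemCones_smul_mem hC hε.le (amp_diagPair_mem (n := n) hC hp hq) using 1
  simp

theorem peirceCones_add_mem (hC : IsMatrixOrdering C)
    {x y : Matrix (Fin n) (Fin n) (Matrix (Fin 2) (Fin 2) V)} (hx : x ∈ peirceCones C e p n)
    (hy : y ∈ peirceCones C e p n) : x + y ∈ peirceCones C e p n := by
  refine ⟨hx.1.add hy.1, fun ε hε => ?_⟩
  obtain ⟨s, hs, hxs⟩ := hx.2 (ε / 2) (by positivity)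
  obtain ⟨t, ht, hyt⟩ := hy.2 (ε / 2) (by positivity)
  refine ⟨s + t, by positivity, ?_⟩
  convert matrixSystemCones_add_mem hC hxs hyt using 1
  push_cast
  module

theorem peirceCones_smul_mem (hC : IsMatrixOrdering C) (hp : IsPos C p) (hq : IsPos C (e - p))
    {r : ℝ} (hr : 0 ≤ r) {x : Matrix (Fin n) (Fin n) (Matrix (Fin 2) (Fin 2) V)}
    (hx : x ∈ peirceCones C e p n) : (r : ℂ) • x ∈ peirceCones C e p n := by
  rcases hr.eq_or_lt with rfl | hr
  · rw [Complex.ofReal_zero, zero_smul]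
    exact mem_peirceCones_of_mem hC hp hq (matrixSystemCones_zero_mem hC)
  refine ⟨IsSelfAdjoint.smul (Complex.conj_ofReal r) hx.1, fun ε hε => ?_⟩
  obtain ⟨t, ht, hxt⟩ := hx.2 (ε / r) (by positivity)
  refine ⟨r * t, by positivity, ?_⟩
  convert matrixSystemCones_smul_mem hC hr.le hxt using 1
  rw [smul_add, smul_add, smul_smul, smul_smul, ← Complex.ofReal_mul, ← Complex.ofReal_mul,
    mul_div_cancel₀ _ hr.ne']

/-- The relative cone need not be proper, but separation needs only an Archimedean order unit, and
the unit of the smaller cone of `M_n(M_2(V))` serves. -/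
theorem exists_positiveFunctional (hV : IsOperatorSystem C e) (hp : IsPos C p)
    (hq : IsPos C (e - p)) {x : Matrix (Fin n) (Fin n) (Matrix (Fin 2) (Fin 2) V)}
    (hx : IsSelfAdjoint x) (hxK : x ∉ peirceCones C e p n) :
    ∃ s : PositiveFunctional (peirceCones C e p n), ¬ 0 ≤ s.toLinearMap x := by
  obtain ⟨s, h1, h2, h3⟩ := exists_positive_functional_of_notMem (peirceCones C e p n)
    (amp n (amp 2 e)) (fun x hx => hx.1)
    (fun x hx y hy => peirceCones_add_mem hV.toIsMatrixOrdering hx hy)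
    (fun r hr x hx => peirceCones_smul_mem hV.toIsMatrixOrdering hp hq hr hx)
    (by
      ext i j k l
      have he : star e = e := hV.unit_isSelfAdjoint
      simp only [amp, Matrix.star_apply, Matrix.diagonal_apply, eq_comm (a := j)]
      by_cases hij : i = j <;> by_cases hkl : k = l <;>
        simp [hij, hkl, he, eq_comm (a := l)])
    (fun x hx => by
      obtain ⟨r, hr, h⟩ := matrixSystemCones_order_unit hV hx
      exact ⟨r, hr, mem_peirceCones_of_mem hV.toIsMatrixOrdering hp hq h⟩)
    peirceCones_archimedean hx hxK
  exact ⟨⟨s, h1, h2⟩, h3⟩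

namespace PositiveFunctional

/-- The form-valued map `x ↦ ((ξ, η) ↦ s (ξ* η ⊗ x))` of a positive functional `s`. -/
def toForm (s : PositiveFunctional (peirceCones C e p n)) (x : V) (ξ η : Fin n → Fin 2 → ℂ) : ℂ :=
  s.toLinearMap (rankOneTensor ξ η x)

theorem isCPForm_toForm (s : PositiveFunctional (peirceCones C e p n)) (hC : IsMatrixOrdering C)
    (hp : IsPos C p) (hq : IsPos C (e - p)) : IsCPForm C s.toForm where
  map_add x y ξ η := by
    rw [toForm, toForm, toForm, ← map_add]
    congr 1
    ext i j k l
    simp [rankOneTensor]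
  map_smul c x ξ η := by
    rw [toForm, toForm, ← smul_eq_mul, ← map_smul]
    congr 1
    ext i j k l
    simp [rankOneTensor, smul_smul, mul_comm c]
  map_star x ξ η := by
    rw [toForm, toForm, ← s.map_star]
    congr 1
    ext i j k l
    simp [rankOneTensor, mul_comm]
  add_right x ξ η ζ := by
    rw [toForm, toForm, toForm, ← map_add]
    congr 1
    ext i j k l
    simp [rankOneTensor, mul_add, add_smul]
  smul_right c x ξ η := by
    rw [toForm, toForm, ← smul_eq_mul, ← map_smul]
    congr 1
    ext i j k l
    simp [rankOneTensor, smul_smul, mul_left_comm]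
  nonneg m x hx ξ := by
    simp only [toForm, ← map_sum]
    exact s.nonneg _ (mem_peirceCones_of_mem hC hp hq (sum_rankOneTensor_mem hC hx ξ))

/-- The projection of `ℂⁿ ⊗ ℂ²` onto `ℂⁿ ⊗ e_0`. -/
def firstComponent (n : ℕ) (η : Fin n → Fin 2 → ℂ) : Fin n → Fin 2 → ℂ :=
  fun i => Pi.single 0 (η i 0)

/-- The form of `p` ignores the second component of `η`, and on the first component the form of `e -
p` vanishes, so `p` may be replaced by `e`. -/
theorem toForm_eq_firstComponent (s : PositiveFunctional (peirceCones C e p n))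
    (hV : IsOperatorSystem C e) (hp : IsPos C p) (hq : IsPos C (e - p))
    (ξ η : Fin n → Fin 2 → ℂ) : s.toForm p ξ η = s.toForm e ξ (firstComponent n η) := by
  have hC := hV.toIsMatrixOrdering
  have hb := s.isCPForm_toForm hC hp hq
  -- Both signs of `(q ⊕ p)_n` lie in the cone, so `s` is zero on it.
  have hzero := le_antisymm
    (by simpa using s.nonneg _ (neg_amp_mem_peirceCones hC hp hq))
    (s.nonneg _ (mem_peirceCones_of_mem hC hp hq (amp_diagPair_mem hC hq hp)))
  rw [amp_diagPair, map_add, map_sum, map_sum] at hzero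
  have hqn : ∀ i ∈ Finset.univ, 0 ≤ s.toForm (e - p) (Pi.single i (Pi.single 0 1))
    (Pi.single i (Pi.single 0 1)) := fun i _ => hb.nonneg_self hq _
  have hpn : ∀ i ∈ Finset.univ, 0 ≤ s.toForm p (Pi.single i (Pi.single 1 1))
    (Pi.single i (Pi.single 1 1)) := fun i _ => hb.nonneg_self hp _
  obtain ⟨hq0, hp0⟩ := (add_eq_zero_iff_of_nonneg (Finset.sum_nonneg hqn)
    (Finset.sum_nonneg hpn)).1 hzero
  rw [Finset.sum_eq_zero_iff_of_nonneg hqn] at hq0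
  rw [Finset.sum_eq_zero_iff_of_nonneg hpn] at hp0
  have decomp : ∀ (k : Fin 2) (c : Fin n → ℂ), (fun i => Pi.single k (c i) : Fin n → Fin 2 → ℂ) =
      ∑ i, c i • Pi.single i (Pi.single k 1) := by
    intro k c
    ext i l
    simp [Finset.sum_apply, Pi.single_apply, ite_apply]
  have vanish : ∀ (x : V) (k : Fin 2) (c : Fin n → ℂ),
      (∀ i, s.toForm x ξ (Pi.single i (Pi.single k 1)) = 0) →
        s.toForm x ξ (fun i => Pi.single k (c i)) = 0 := by
    intro x k c h
    have := map_sum (hb.form x ξ) (fun i => c i • (Pi.single i (Pi.single k 1) : Fin n → Fin 2 → ℂ))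
      Finset.univ
    rw [decomp]
    refine this.trans (Finset.sum_eq_zero fun i _ => ?_)
    rw [map_smul]
    change _ • s.toForm x ξ _ = 0
    rw [h, smul_zero]
  have h1 := vanish (e - p) 0 (fun i => η i 0) fun i =>
    hb.eq_zero_of_self_eq_zero hq (hC.isSelfAdjoint_of_isPos hq) (hq0 i (Finset.mem_univ i)) ξ
  have h2 := vanish p 1 (fun i => η i 1) fun i =>
    hb.eq_zero_of_self_eq_zero hp (hC.isSelfAdjoint_of_isPos hp) (hp0 i (Finset.mem_univ i)) ξ
  have hη : η = firstComponent n η + fun i => Pi.single 1 (η i 1) := by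
    ext i l
    fin_cases l <;> simp [firstComponent]
  calc s.toForm p ξ η = s.toForm p ξ (firstComponent n η) := by
        conv_lhs => rw [hη]
        rw [hb.add_right, h2, add_zero]
    _ = s.toForm (e - p) ξ (firstComponent n η) + s.toForm p ξ (firstComponent n η) := by
        rw [show s.toForm (e - p) ξ (firstComponent n η) = 0 from h1, zero_add]
    _ = s.toForm e ξ (firstComponent n η) := by rw [← hb.map_add, sub_add_cancel]

end PositiveFunctional

end Peirce

theorem theorem4p20 {V : Type u} [AddCommGroup V] [Module ℂ V] [StarAddMonoid V] [StarModule ℂ V]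
    (C : MatrixCones V) (e : V) (hV : IsOperatorSystem C e)
    (p : V) (hp : IsAbstractProjection C e p) :
    ∃ (H : Type u) (_ : NormedAddCommGroup H) (_ : InnerProductSpace ℂ H) (_ : CompleteSpace H)
      (π : V →ₗ[ℂ] (H →L[ℂ] H)),
      π e = 1 ∧ IsCompleteOrderEmbedding C (operatorCones H) π ∧ IsStarProjection (π p) := by
  classical
  let b := directSumForm fun s : Σ n, PositiveFunctional (peirceCones C e p n) => s.2.toForm
  have hb : IsCPForm C b := IsCPForm.directSum fun s =>
    s.2.isCPForm_toForm hV.toIsMatrixOrdering hp.pos hp.le_unit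
  refine hb.exists_embedding hV (fun n x hx hnonneg => ?_) hp.pos
    (DFinsupp.mapRange (fun s => PositiveFunctional.firstComponent s.1) fun s => by
      ext; simp [PositiveFunctional.firstComponent]) (fun v => ?_) (fun u v => ?_)
  · refine hp.isCompleteOrderEmbedding.mem_of_map_mem n x ⟨x.map (constMatrix V), ?_, by ext; rfl⟩
    by_contra hK
    have hsa : IsSelfAdjoint (x.map (constMatrix V)) := by
      ext i j k l
      have := congrFun (congrFun hx i) j
      rw [Matrix.conjTranspose_apply] at this
      fin_cases k <;> fin_cases l <;> simpa [constMatrix] using this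
    obtain ⟨s, hs⟩ := exists_positiveFunctional hV hp.pos hp.le_unit hsa hK
    apply hs
    -- The test vectors sit in the single summand of the separating functional `s`, at `e_a ⊗ (1,
    -- 1)`.
    have h := hnonneg fun a => DFinsupp.single ⟨n, s⟩ (Pi.single a 1)
    have hsingle : ∀ (x : V) (ξ η : Fin n → Fin 2 → ℂ),
        b x (DFinsupp.single ⟨n, s⟩ ξ) (DFinsupp.single ⟨n, s⟩ η) = s.toForm x ξ η := by
      intro x ξ η
      refine (finsum_eq_single _ ⟨n, s⟩ fun i hi => ?_).trans (by simp)
      rw [DFinsupp.single_eq_of_ne hi, DFinsupp.single_eq_of_ne hi]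
      simpa using (i.2.isCPForm_toForm hV.toIsMatrixOrdering hp.pos hp.le_unit).smul_right 0 x 0 0
    simp only [hsingle, PositiveFunctional.toForm, ← map_sum] at h
    rwa [sum_rankOneTensor_single] at h
  · ext s i k
    simp [PositiveFunctional.firstComponent]
  · refine finsum_congr fun s => ?_
    rw [DFinsupp.mapRange_apply]
    exact s.2.toForm_eq_firstComponent hV hp.pos hp.le_unit _ _
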